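/- An MTL-algebra is a prelinear, commutative, bounded, integral residuated lattice $(A,*,\Rightarrow,\sqcap,\sqcup,0,1)$; a variety of MTL-algebras is a class of MTL-algebras defined by a set of equations in this language. Write $\sim x := x\Rightarrow 0$, $x^0:=1$, $x^{n+1}:=x^n*x$. For an integer $k>1$, $\mathbb{S}_k\mathbb{MTL}$ is the variety of MTL-algebras satisfying $x\sqcup\sim(x^{k-1})=1$. For a variety $\mathbb{L}$ of MTL-algebras, $\mathbb{L}_\Delta$ is the variety of all pairs $(A,\Delta)$ with $A\in\mathbb{L}$ and $\Delta\colon A\to A$ a unary operation satisfying, for all $x,y\in A$, $$\Delta x\sqcup\sim\Delta x=1,\quad \Delta x\Rightarrow x=1,\quad \Delta x\Rightarrow\Delta\Delta x=1,\quad \Delta(x\Rightarrow y)\Rightarrow(\Delta x\Rightarrow\Delta y)=1,\quad \Delta(x\sqcup y)\Rightarrow(\Delta x\sqcup\Delta y)=1,\quad \Delta 1=1.$$ A unary term $t$ in the language of MTL-algebras defines $\Delta$ in $\mathbb{L}$ if the members of $\mathbb{L}_\Delta$ are exactly the pairs $(A,t^A)$ with $A\in\mathbb{L}$, where $t^A$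 is the term operation of $t$ on $A$. We write $\mathbb{L}_\Delta=\mathbb{L}$ ("$\Delta$ is definable in $\mathbb{L}$") if some unary term defines $\Delta$ in $\mathbb{L}$. Theorem. Let $\mathbb{L}$ be a variety of MTL-algebras. Then $\mathbb{L}_\Delta=\mathbb{L}$ if and only if $\mathbb{L}$ is a subvariety of $\mathbb{S}_k\mathbb{MTL}$ for some integer $k>1$. Moreover, for every integer $k>1$ such that $\mathbb{L}$ is a subvariety of $\mathbb{S}_k\mathbb{MTL}$, the term $x^{k-1}$ defines $\Delta$ in $\mathbb{L}$. -/

import Mathlib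

universe u v

/-- An MTL-algebra `(A, *, ⇨, ⊓, ⊔, ⊥, 1)`: a prelinear, commutative, bounded, integral residuated
lattice.  The trivial (one-element) algebra is allowed. -/
class MTLAlgebra (A : Type u) extends Lattice A, OrderBot A, CommMonoid A, HImp A where
  /-- Integrality: the monoid unit is the top element. -/
  le_one' : ∀ x : A, x ≤ 1
  /-- `⇨` is the residuum of `*`. -/
  residuation : ∀ x y z : A, x * y ≤ z ↔ x ≤ y ⇨ z
  prelinearity : ∀ x y : A, (x ⇨ y) ⊔ (y ⇨ x) = 1

/-- Bundled MTL-algebras with carrier in `Type u`. -/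
structure MTLAlg : Type (u + 1) where
  carrier : Type u
  [str : MTLAlgebra carrier]

attribute [instance] MTLAlg.str

instance : CoeSort MTLAlg.{u} (Type u) := ⟨MTLAlg.carrier⟩

/-- Terms in the language of MTL-algebras with variables in `X`. -/
inductive MTLTerm (X : Type v) : Type v where
  | var : X → MTLTerm X
  | zero : MTLTerm X
  | one : MTLTerm X
  | mul : MTLTerm X → MTLTerm X → MTLTerm X
  | imp : MTLTerm X → MTLTerm X → MTLTerm X
  | inf : MTLTerm X → MTLTerm X → MTLTerm X
  | sup : MTLTerm X → MTLTerm X → MTLTerm X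

namespace MTLTerm

variable {X : Type v}

/-- Negation `¬ t := t → 0`. -/
def neg (t : MTLTerm X) : MTLTerm X := imp t zero

/-- Powers: `t ^ 0 := 1`, `t ^ (n + 1) := t ^ n * t`. -/
def pow (t : MTLTerm X) : ℕ → MTLTerm X
  | 0 => one
  | n + 1 => mul (pow t n) t

/-- Value of a term in an MTL-algebra under a valuation of its variables. -/
def eval {A : Type u} [MTLAlgebra A] (v : X → A) : MTLTerm X → A
  | var x => v x
  | zero => ⊥
  | one => 1
  | mul s t => eval v s * eval v t
  | imp s t => eval v s ⇨ eval v t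
  | inf s t => eval v s ⊓ eval v t
  | sup s t => eval v s ⊔ eval v t

end MTLTerm

/-- The class of all MTL-algebras satisfying every equation `s = t` with `(s, t) ∈ E`. -/
def mtlModels (E : Set (MTLTerm ℕ × MTLTerm ℕ)) : Set MTLAlg.{u} :=
  {A | ∀ e ∈ E, ∀ v : ℕ → A, e.1.eval v = e.2.eval v}

/-- A variety of MTL-algebras: a class of MTL-algebras defined by a set of equations. -/
def IsMTLVariety (L : Set MTLAlg.{u}) : Prop :=
  ∃ E : Set (MTLTerm ℕ × MTLTerm ℕ), L = mtlModels E

/-- The variety `S_k MTL` (meaningful for `k ≥ 2`): MTL-algebras satisfying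
`x ∨ ¬ (x ^ (k - 1)) = 1`. -/
def SkMTL (k : ℕ) : Set MTLAlg.{u} :=
  mtlModels {(MTLTerm.sup (MTLTerm.var 0) (MTLTerm.neg ((MTLTerm.var 0).pow (k - 1))),
    MTLTerm.one)}

/-- An MTL-algebra together with an additional unary operation. -/
structure MTLAlgWithOp : Type (u + 1) where
  reduct : MTLAlg.{u}
  op : reduct → reduct

/-- The identities of the `Δ` projection operator on an MTL-algebra.  The first five correspond to
the axioms for `Δ`; the last one corresponds to the necessitation rule (from `φ` infer `Δ φ`). -/
structure IsDelta {A : Type u} [MTLAlgebra A] (Δ : A → A) : Prop where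
  em : ∀ x, Δ x ⊔ (Δ x ⇨ ⊥) = 1
  deflation : ∀ x, Δ x ⇨ x = 1
  idem : ∀ x, Δ x ⇨ Δ (Δ x) = 1
  map_imp : ∀ x y, Δ (x ⇨ y) ⇨ (Δ x ⇨ Δ y) = 1
  map_sup : ∀ x y, Δ (x ⊔ y) ⇨ (Δ x ⊔ Δ y) = 1
  map_one : Δ 1 = 1

/-- The variety `L_Δ`: members of `L` expanded with an operation satisfying the identities
of `Δ`. -/
def deltaVariety (L : Set MTLAlg.{u}) : Set MTLAlgWithOp.{u} :=
  {B | B.reduct ∈ L ∧ IsDelta B.op}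

/-- The unary term `t` defines `Δ` in `L`: the members of `L_Δ` are exactly the members of `L`
expanded with the term operation of `t`. -/
def DeltaDefinedBy (L : Set MTLAlg.{u}) (t : MTLTerm Unit) : Prop :=
  ∀ B : MTLAlgWithOp.{u},
    B ∈ deltaVariety L ↔ B.reduct ∈ L ∧ ∀ x : B.reduct, B.op x = t.eval (fun _ => x)

/-- `L_Δ = L`: the operator `Δ` is definable in `L` by a term in the language of MTL-algebras. -/
def DeltaDefinable (L : Set MTLAlg.{u}) : Prop :=
  ∃ t : MTLTerm Unit, DeltaDefinedBy L t

namespace MTLAlgebra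

variable {A : Type u} [MTLAlgebra A]

/-! If a term `t` defines `Δ`, its Lipschitz bound (`exists_pow_mul_eval_le`), used between `1` and
`x` with `c = x`, gives `n` depending only on `t` with `x ^ n = x ^ n * Δ 1 ≤ Δ x`. Then `Δ x ≤ x`
turns `Δ x ⊔ ¬Δ x = 1` into `x ⊔ ¬x ^ n = 1`. Conversely, this identity makes `x ^ n` complemented,
hence idempotent, and squeezes every `Δ` onto it (`IsDelta.eq_pow`). -/

theorem le_imp_iff {x y z : A} : x ≤ y ⇨ z ↔ x * y ≤ z := (residuation x y z).symm

instance : IsOrderedMonoid A where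
  mul_le_mul_left a b h c := by
    rw [residuation]
    exact h.trans (le_imp_iff.2 le_rfl)

theorem imp_mul_le (x y : A) : (x ⇨ y) * x ≤ y := le_imp_iff.1 le_rfl

theorem one_le_iff {x : A} : 1 ≤ x ↔ x = 1 := (le_one' x).ge_iff_eq

theorem imp_eq_one_iff {x y : A} : x ⇨ y = 1 ↔ x ≤ y := by
  rw [← one_le_iff, le_imp_iff, one_mul]

theorem mul_le_left (x y : A) : x * y ≤ x :=
  mul_le_of_le_one_right' (le_one' y)

theorem mul_le_right (x y : A) : x * y ≤ y :=
  mul_le_of_le_one_left' (le_one' x)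

theorem mul_sup_le {x y z w : A} (hy : x * y ≤ w) (hz : x * z ≤ w) : x * (y ⊔ z) ≤ w := by
  rw [mul_comm, residuation]
  exact sup_le (le_imp_iff.2 (by rwa [mul_comm])) (le_imp_iff.2 (by rwa [mul_comm]))

/-- Case distinction on a cover of `1`; it does the work of a reduction to chains. -/
theorem le_of_sup_eq_one {x y z w : A} (h : y ⊔ z = 1) (hy : x * y ≤ w) (hz : x * z ≤ w) :
    x ≤ w := by
  simpa [h] using mul_sup_le hy hz

theorem pow_sup_eq_one {x y : A} (h : x ⊔ y = 1) (n : ℕ) : x ^ n ⊔ y = 1 := by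
  induction n with
  | zero => simpa using le_one' y
  | succ n ih =>
    refine one_le_iff.1 (ih.ge.trans (sup_le ?_ le_sup_right))
    exact le_of_sup_eq_one h ((pow_succ x n).ge.trans le_sup_left)
      ((mul_le_right _ _).trans le_sup_right)

theorem mul_neg_self (x : A) : x * (x ⇨ ⊥) = ⊥ := by
  rw [mul_comm]
  exact le_bot_iff.1 (imp_mul_le x ⊥)

theorem mul_self_of_sup_neg {e : A} (h : e ⊔ (e ⇨ ⊥) = 1) : e * e = e :=
  le_antisymm (mul_le_left e e)
    (le_of_sup_eq_one h le_rfl ((mul_neg_self e).le.trans bot_le))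

theorem pow_eq_self_of_sup_neg {e : A} (h : e ⊔ (e ⇨ ⊥) = 1) {n : ℕ} (hn : n ≠ 0) :
    e ^ n = e :=
  IsIdempotentElem.pow_eq (mul_self_of_sup_neg h) hn

theorem sup_mul_imp_le (x y : A) : (x ⊔ y) * (x ⇨ y) ≤ y := by
  rw [mul_comm]
  exact mul_sup_le (imp_mul_le x y) (mul_le_right _ _)

/-- Prelinearity survives taking powers, and a factor `x ⇨ y` pushes `x ⊔ y` below `y`. -/
theorem sup_pow_le (x y : A) (n : ℕ) : (x ⊔ y) ^ n ≤ x ^ n ⊔ y ^ n := by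
  have h : (x ⇨ y) ^ n ⊔ (y ⇨ x) ^ n = 1 := by
    rw [sup_comm]
    exact pow_sup_eq_one ((sup_comm _ _).trans (pow_sup_eq_one (prelinearity x y) n)) n
  refine le_of_sup_eq_one h ?_ ?_
  · rw [← mul_pow]
    exact (pow_le_pow_left' (sup_mul_imp_le x y) n).trans le_sup_right
  · rw [← mul_pow, sup_comm x y]
    exact (pow_le_pow_left' (sup_mul_imp_le y x) n).trans le_sup_left

/-- If `x ⊔ ¬ x ^ n = 1` holds identically, then `x ^ n` is a `Δ` operator. -/
theorem isDelta_pow {n : ℕ} (hn : n ≠ 0) (h : ∀ x : A, x ⊔ (x ^ n ⇨ ⊥) = 1) :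
    IsDelta (fun x : A => x ^ n) where
  em x := pow_sup_eq_one (h x) n
  deflation x := by
    obtain ⟨m, rfl⟩ := Nat.exists_eq_succ_of_ne_zero hn
    rw [imp_eq_one_iff, pow_succ]
    exact mul_le_right _ _
  idem x := imp_eq_one_iff.2 (pow_eq_self_of_sup_neg (pow_sup_eq_one (h x) n) hn).ge
  map_imp x y := by
    rw [imp_eq_one_iff, le_imp_iff, ← mul_pow]
    exact pow_le_pow_left' (imp_mul_le x y) n
  map_sup x y := imp_eq_one_iff.2 (sup_pow_le x y n)
  map_one := one_pow n

end MTLAlgebra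

open MTLAlgebra

/-- If `x ⊔ ¬ x ^ n = 1` holds identically, then `x ^ n` is the only `Δ` operator. -/
theorem IsDelta.eq_pow {A : Type u} [MTLAlgebra A] {Δ : A → A} (hΔ : IsDelta Δ) {n : ℕ}
    (hn : n ≠ 0) (h : ∀ x : A, x ⊔ (x ^ n ⇨ ⊥) = 1) (x : A) : Δ x = x ^ n := by
  have hle (y : A) : Δ y ≤ y := imp_eq_one_iff.1 (hΔ.deflation y)
  apply le_antisymm
  -- `Δ x` is complemented, hence idempotent.
  · rw [← pow_eq_self_of_sup_neg (hΔ.em x) hn]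
    exact pow_le_pow_left' (hle x) n
  -- Apply `Δ` to the identity; `x ^ n` annihilates the second joinand.
  · have hs : Δ x ⊔ Δ (x ^ n ⇨ ⊥) = 1 := by
      have := imp_eq_one_iff.1 (hΔ.map_sup x (x ^ n ⇨ ⊥))
      rwa [h, hΔ.map_one, one_le_iff] at this
    refine le_of_sup_eq_one hs (mul_le_right _ _) ?_
    exact ((mul_le_mul_right (hle _) _).trans (mul_neg_self _).le).trans bot_le

namespace MTLTerm

variable {X : Type v}

theorem eval_pow {A : Type u} [MTLAlgebra A] (w : X → A) (t : MTLTerm X) (n : ℕ) :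
    (t.pow n).eval w = t.eval w ^ n := by
  induction n with
  | zero => exact (pow_zero _).symm
  | succ n ih => rw [pow_succ, ← ih]; rfl

/-- Term operations are Lipschitz for the biresiduum, with a constant depending on the term only. -/
theorem exists_pow_mul_eval_le (t : MTLTerm X) :
    ∃ n : ℕ, ∀ (A : Type u) [MTLAlgebra A] (c : A) (v w : X → A),
      (∀ i, c * v i ≤ w i) → (∀ i, c * w i ≤ v i) → c ^ n * t.eval v ≤ t.eval w := by
  induction t with
  | var i => exact ⟨1, fun A _ c v w h _ => by simpa [eval] using h i⟩
  | zero => exact ⟨0, fun A _ c v w _ _ => mul_le_right _ _⟩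
  | one => exact ⟨0, fun A _ c v w _ _ => mul_le_right _ _⟩
  | mul s t hs ht =>
    obtain ⟨m, hm⟩ := hs
    obtain ⟨n, hn⟩ := ht
    refine ⟨m + n, fun A _ c v w h h' => ?_⟩
    rw [pow_add, eval, mul_mul_mul_comm]
    exact mul_le_mul' (hm A c v w h h') (hn A c v w h h')
  | imp s t hs ht =>
    obtain ⟨m, hm⟩ := hs
    obtain ⟨n, hn⟩ := ht
    refine ⟨m + n, fun A _ c v w h h' => ?_⟩
    rw [eval, eval, le_imp_iff]
    calc c ^ (m + n) * (s.eval v ⇨ t.eval v) * s.eval w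
        = c ^ n * ((s.eval v ⇨ t.eval v) * (c ^ m * s.eval w)) := by
          rw [pow_add]; ac_rfl
      _ ≤ c ^ n * t.eval v := by
          gcongr
          -- The antecedent is contravariant, so `v` and `w` swap roles; hence the symmetric
          -- hypotheses.
          exact (mul_le_mul_right (hm A c w v h' h) _).trans (imp_mul_le _ _)
      _ ≤ t.eval w := hn A c v w h h'
  | inf s t hs ht =>
    obtain ⟨m, hm⟩ := hs
    obtain ⟨n, hn⟩ := ht
    refine ⟨m + n, fun A _ c v w h h' => le_inf ?_ ?_⟩ <;> rw [pow_add]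
    · exact (mul_le_mul' (mul_le_left _ _) inf_le_left).trans (hm A c v w h h')
    · exact (mul_le_mul' (mul_le_right _ _) inf_le_right).trans (hn A c v w h h')
  | sup s t hs ht =>
    obtain ⟨m, hm⟩ := hs
    obtain ⟨n, hn⟩ := ht
    refine ⟨m + n, fun A _ c v w h h' => mul_sup_le ?_ ?_⟩ <;> rw [pow_add]
    · exact ((mul_le_mul_left (mul_le_left _ _) _).trans (hm A c v w h h')).trans le_sup_left
    · exact ((mul_le_mul_left (mul_le_right _ _) _).trans (hn A c v w h h')).trans le_sup_right

end MTLTerm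

theorem mem_SkMTL_iff {k : ℕ} {A : MTLAlg.{u}} :
    A ∈ SkMTL k ↔ ∀ x : A, x ⊔ (x ^ (k - 1) ⇨ ⊥) = 1 := by
  simp only [SkMTL, mtlModels, Set.mem_ofPred_eq, Set.mem_singleton_iff, forall_eq, MTLTerm.eval,
    MTLTerm.neg, MTLTerm.eval_pow]
  exact ⟨fun h x => h fun _ => x, fun h w => h (w 0)⟩

theorem deltaDefinedBy_pow {L : Set MTLAlg.{u}} {k : ℕ} (hk : 1 < k) (hL : L ⊆ SkMTL k) :
    DeltaDefinedBy L ((MTLTerm.var ()).pow (k - 1)) := by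
  have hk' : k - 1 ≠ 0 := by omega
  intro B
  refine and_congr_right fun hB => ?_
  have h := mem_SkMTL_iff.1 (hL hB)
  simp only [MTLTerm.eval_pow, MTLTerm.eval]
  refine ⟨fun hΔ => hΔ.eq_pow hk' h, fun hop => ?_⟩
  rw [funext hop]
  exact isDelta_pow hk' h

theorem DeltaDefinable.exists_subset_SkMTL {L : Set MTLAlg.{u}} (h : DeltaDefinable L) :
    ∃ k : ℕ, 1 < k ∧ L ⊆ SkMTL k := by
  obtain ⟨t, ht⟩ := h
  obtain ⟨n, hn⟩ := t.exists_pow_mul_eval_le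
  -- `n + 1` would violate `1 < k` when `n = 0`; the extra factor of `x` is harmless.
  refine ⟨n + 2, by omega, fun A hA => mem_SkMTL_iff.2 fun x => ?_⟩
  have hΔ : IsDelta (fun x : A => t.eval fun _ => x) :=
    ((ht ⟨A, fun x => t.eval fun _ => x⟩).2 ⟨hA, fun _ => rfl⟩).2
  have hx : x ^ n ≤ t.eval fun _ => x := by
    have := hn A x (fun _ => 1) (fun _ => x) (fun _ => (mul_one x).le) (fun _ => le_one' _)
    rwa [hΔ.map_one, mul_one] at this
  refine one_le_iff.1 ((hΔ.em x).ge.trans (sup_le_sup (imp_eq_one_iff.1 (hΔ.deflation x)) ?_))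
  refine le_imp_iff.2 ((mul_le_mul_right (le_trans ?_ hx) _).trans (imp_mul_le _ ⊥))
  rw [show n + 2 - 1 = n + 1 from rfl, pow_succ]
  exact mul_le_left _ _

theorem theorem5p3 (L : Set MTLAlg.{u}) (hL : IsMTLVariety L) :
    (DeltaDefinable L ↔ ∃ k : ℕ, 1 < k ∧ L ⊆ SkMTL k) ∧
      ∀ k : ℕ, 1 < k → L ⊆ SkMTL k →
        DeltaDefinedBy L ((MTLTerm.var ()).pow (k - 1)) :=
  ⟨⟨DeltaDefinable.exists_subset_SkMTL, fun ⟨_, hk, h⟩ => ⟨_, deltaDefinedBy_pow hk h⟩⟩,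
    fun _ hk h => deltaDefinedBy_pow hk h⟩
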